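/- **Setting.** Let $T\in\mathbb N$, let $\mathcal F$ be a (possibly infinite) class of functions $f:\mathcal X\times\mathcal A\to[0,1]$ with a prior distribution $p_0$ on $\mathcal F$, and let $f_*\in\mathcal F$ be the true reward function. In round $t=1,\dots,T$ the agent receives a context $x_t$ (which may depend arbitrarily on the past) and a context-dependent action set $\mathcal A_t=\mathcal A_t(x_t)\subset\mathcal A$, chooses $a_t\in\mathcal A_t$, and observes $r_t=f_*(x_t,a_t)+\epsilon_t$. The noise is $\sigma_t^2$-subgaussian for a deterministic revealed sequence $\sigma_t\ge0$: $\mathbb E[\exp(u\epsilon_t)\mid\mathcal G_t]\le\exp(\sigma_t^2u^2/8)$ for all $u\in\mathbb R$, where $\mathcal G_t$ is generated by all the randomness up to round $t$ except $r_t$. Put $\Lambda=\sum_{t=1}^T\sigma_t^2$. **Algorithm (FGTS-VA).** Let $\alpha>0$, $c\ge 0$, $\bar\sigma_t=\max\{\sigma_t,\alpha\}$, $\Lambda_t=\sum_{s\le t}\bar\sigma_s^2$, $\lambda_t=c\sqrt{\Lambda_t}/\bar\sigma_t^2$. In round $t$, given the past and $x_t$, the agent samples $f_t$ from $$p_t(f)\propto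 p_0(f)\exp\Big(-\sum_{s=1}^{t-1}\bar\sigma_s^{-2}(r_s-f(x_s,a_s))^2+\lambda_t\max_{a\in\mathcal A_t}f(x_t,a)\Big)$$ and plays $a_t\in\operatorname{argmax}_{a\in\mathcal A_t}f_t(x_t,a)$. The regret is $\mathrm{Regret}(T)=\sum_{t=1}^T\big[\max_{a\in\mathcal A_t}f_*(x_t,a)-f_*(x_t,a_t)\big]$. **Decoupling coefficient.** For $z=(z_t)_{t\le T}$ in $\mathcal X\times\mathcal A$ and $\beta_t>0$, let $\mathrm{dc}_\lambda(\mathcal F,z,\beta)$ be the smallest number $d$ such that $$\sum_{t=1}^T(f_t(z_t)-f_*(z_t))\le\sum_{t=1}^T\frac{\gamma}{\beta_t}\sum_{s=1}^{t-1}\beta_s(f_t(z_s)-f_*(z_s))^2+\gamma\lambda\sum_{t=1}^T\frac1{\beta_t}+\Big(1+\frac1{4\gamma}\Big)d$$ for all $f_1,\dots,f_T\in\mathcal F$ and all $\gamma>0$. Let $\mathrm{dc}_{\lambda,\epsilon,T}(\mathcal F)$ be its supremum over all $z$ and all $\beta$ with $0<\beta_t\le\epsilon$, and write $\mathrm{dc}=\mathrm{dc}_{1,\alpha^{-2},T}(\mathcal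 F)$; assume $\mathrm{dc}>0$. **Potential.** With $\Delta L(f,x,a,r)=(r-f(x,a))^2-(r-f_*(x,a))^2$ and $\mathrm{FG}_t(f)=\max_{a\in\mathcal A_t}f(x_t,a)-\max_{a\in\mathcal A_t}f_*(x_t,a)$, define $$Z_t=-\mathbb E\log\mathbb E_{f\sim p_0}\exp\Big(-\sum_{s=1}^{t-1}\bar\sigma_s^{-2}\Delta L(f,x_s,a_s,r_s)+\lambda_t\,\mathrm{FG}_t(f)\Big),\qquad Z=1\vee\sup_{(\sigma_t)\in\mathcal S}\ \max_{1\le t\le T}Z_t,$$ where $\mathcal S$ is any set of admissible (nonnegative) variance sequences and, for each sequence in $\mathcal S$, $Z_t$ is computed for the run of FGTS-VA with that sequence and the given $\alpha,c$. **Theorem.** If $Z<\infty$ and $c=2\sqrt{Z/\mathrm{dc}}$, then for every sequence $(\sigma_t)\in\mathcal S$ for which the noise is $\sigma_t^2$-subgaussian as above, the regret of FGTS-VA run with this sequence satisfies $$\mathbb E[\mathrm{Regret}(T)]\le\frac94\sqrt{(\alpha^2T+\Lambda)\,Z\,\mathrm{dc}}+\mathrm{dc}.$$ -/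

import Mathlib

open MeasureTheory ProbabilityTheory

noncomputable section

/-- The known data of a contextual bandit problem with contexts `X`, actions `A` and horizon `T`
(rounds are indexed by `Fin T`), together with a reward function class `{reward θ : θ ∈ Θ}` of
`[0,1]`-valued functions, possibly infinite, and a prior distribution on the class. The action set
of round `t` is `actions t x` when the context is `x`. The true reward function is
`reward truth`, a member of the class. -/
structure BanditProblem (X A Θ : Type*) [MeasurableSpace X] [MeasurableSpace A]
    [MeasurableSpace Θ] (T : ℕ) where
  reward : Θ → X → A → ℝ
  truth : Θ
  actions : Fin T → X → Set A
  prior : Measure Θ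
  prior_prob : IsProbabilityMeasure prior
  reward_mem : ∀ θ x a, reward θ x a ∈ Set.Icc (0 : ℝ) 1
  measurable_reward : Measurable fun q : Θ × X × A => reward q.1 q.2.1 q.2.2
  measurable_max : ∀ t, Measurable fun q : Θ × X =>
    sSup ((fun a => reward q.1 q.2 a) '' actions t q.2)

/-- A probability space with the random variables of an interaction of `T` rounds: contexts `x`,
sampled members `θ` of the function class, chosen actions `a` and observed rewards `r`. -/
structure Interaction (Ω X A Θ : Type*) [MeasurableSpace Ω] [MeasurableSpace X]
    [MeasurableSpace A] [MeasurableSpace Θ] (T : ℕ) where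
  P : Measure Ω
  P_prob : IsProbabilityMeasure P
  x : Fin T → Ω → X
  θ : Fin T → Ω → Θ
  a : Fin T → Ω → A
  r : Fin T → Ω → ℝ
  measurable_x : ∀ t, Measurable (x t)
  measurable_θ : ∀ t, Measurable (θ t)
  measurable_a : ∀ t, Measurable (a t)
  measurable_r : ∀ t, Measurable (r t)

/-- `σ̄_t = max {σ_t, α}`. -/
def sigmaBar {T : ℕ} (α : ℝ) (σ : Fin T → ℝ) (t : Fin T) : ℝ := max (σ t) α

/-- `Λ_t = ∑_{s ≤ t} σ̄_s²`. -/
def LambdaBar {T : ℕ} (α : ℝ) (σ : Fin T → ℝ) (t : Fin T) : ℝ :=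
  ∑ s ∈ Finset.Iic t, sigmaBar α σ s ^ 2

/-- The feel-good weight `λ_t = c √Λ_t / σ̄_t²`. -/
def feelGoodWeight {T : ℕ} (α c : ℝ) (σ : Fin T → ℝ) (t : Fin T) : ℝ :=
  c * √(LambdaBar α σ t) / sigmaBar α σ t ^ 2

namespace BanditProblem

variable {X A Θ : Type*} [MeasurableSpace X] [MeasurableSpace A] [MeasurableSpace Θ] {T : ℕ}
  (B : BanditProblem X A Θ T)

/-- `max_{a ∈ A_t} f_θ(x, a)` for the action set `A_t` of round `t` in context `x`. -/
def maxReward (t : Fin T) (θ : Θ) (x : X) : ℝ :=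
  sSup ((fun a => B.reward θ x a) '' B.actions t x)

/-- The true reward function. -/
def trueReward (x : X) (a : A) : ℝ := B.reward B.truth x a

/-- `ΔL(f, x, a, r) = (r - f(x, a))² - (r - f_*(x, a))²`. -/
def deltaL (θ : Θ) (x : X) (a : A) (r : ℝ) : ℝ :=
  (r - B.reward θ x a) ^ 2 - (r - B.trueReward x a) ^ 2

/-- `FG_t(f) = max_{a ∈ A_t} f(x, a) - max_{a ∈ A_t} f_*(x, a)`. -/
def feelGood (t : Fin T) (θ : Θ) (x : X) : ℝ :=
  B.maxReward t θ x - B.maxReward t B.truth x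

/-- The inequality defining the decoupling coefficient for a sequence `z` of context-action pairs
and weights `β`. -/
def DecouplingBound (lam : ℝ) (z : Fin T → X × A) (β : Fin T → ℝ) (d : ℝ) : Prop :=
  ∀ (θ : Fin T → Θ) (γ : ℝ), 0 < γ →
    ∑ t, (B.reward (θ t) (z t).1 (z t).2 - B.trueReward (z t).1 (z t).2) ≤
      ∑ t, γ / β t * ∑ s ∈ Finset.Iio t,
          β s * (B.reward (θ t) (z s).1 (z s).2 - B.trueReward (z s).1 (z s).2) ^ 2
        + γ * lam * ∑ t, 1 / β t + (1 + 1 / (4 * γ)) * d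

/-- The smallest number satisfying the decoupling inequality. -/
def decouplingAt (lam : ℝ) (z : Fin T → X × A) (β : Fin T → ℝ) : ℝ :=
  sInf {d | B.DecouplingBound lam z β d}

/-- The generalized decoupling coefficient `dc_{λ, ε, T}`. -/
def decoupling (lam ε : ℝ) : ℝ :=
  sSup {d | ∃ (z : Fin T → X × A) (β : Fin T → ℝ),
    (∀ t, 0 < β t ∧ β t ≤ ε) ∧ d = B.decouplingAt lam z β}

/-- The smallest number in the definition of `decouplingAt` exists and lies in `[0, T]`. -/
theorem decouplingAt_isLeast (lam : ℝ) (hlam : 0 ≤ lam) (z : Fin T → X × A) (β : Fin T → ℝ)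
    (hβ : ∀ t, 0 < β t) :
    IsLeast {d | B.DecouplingBound lam z β d} (B.decouplingAt lam z β) ∧
      0 ≤ B.decouplingAt lam z β ∧ B.decouplingAt lam z β ≤ T := by
  have hK : 0 ≤ lam * ∑ t, 1 / β t :=
    mul_nonneg hlam (Finset.sum_nonneg fun t _ => (one_div_pos.2 (hβ t)).le)
  have hT : (T : ℝ) ∈ {d | B.DecouplingBound lam z β d} := by
    intro θ γ hγ
    have h1 : ∑ t, (B.reward (θ t) (z t).1 (z t).2 - B.trueReward (z t).1 (z t).2) ≤ T := by
      refine (Finset.sum_le_sum (g := fun _ => (1 : ℝ)) fun t _ => ?_).trans (by simp)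
      have h2 := (B.reward_mem (θ t) (z t).1 (z t).2).2
      have h3 := (B.reward_mem B.truth (z t).1 (z t).2).1
      simp only [trueReward]
      linarith
    have h4 : 0 ≤ ∑ t, γ / β t * ∑ s ∈ Finset.Iio t,
        β s * (B.reward (θ t) (z s).1 (z s).2 - B.trueReward (z s).1 (z s).2) ^ 2 :=
      Finset.sum_nonneg fun t _ => mul_nonneg (div_nonneg hγ.le (hβ t).le)
        (Finset.sum_nonneg fun s _ => mul_nonneg (hβ s).le (sq_nonneg _))
    have h5 : 0 ≤ γ * lam * ∑ t, 1 / β t := by rw [mul_assoc]; exact mul_nonneg hγ.le hK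
    have h6 : 0 ≤ 1 / (4 * γ) * (T : ℝ) := by positivity
    linarith
  have h0 : ∀ d ∈ {d | B.DecouplingBound lam z β d}, 0 ≤ d := by
    intro d hd
    by_contra! hneg
    set K := lam * ∑ t, 1 / β t with hKdef
    obtain ⟨γ, hγ, hγ1, hγ2⟩ : ∃ γ : ℝ, 0 < γ ∧ γ ≤ 1 ∧ γ * (4 * (K + 1)) ≤ -d := by
      refine ⟨min 1 (-d / (4 * (K + 1))), lt_min one_pos (div_pos (by linarith) (by linarith)),
        min_le_left _ _, ?_⟩
      rw [← le_div_iff₀ (by linarith)]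
      exact min_le_right _ _
    have h := hd (fun _ => B.truth) γ hγ
    simp only [trueReward, sub_self, Finset.sum_const_zero, ne_eq, OfNat.ofNat_ne_zero,
      not_false_eq_true, zero_pow, mul_zero, zero_add] at h
    rw [mul_assoc, ← hKdef] at h
    have h7 : (1 + 1 / (4 * γ)) * d * (4 * γ) = 4 * γ * d + d := by field_simp
    have h8 := mul_nonneg h (by positivity : 0 ≤ 4 * γ)
    rw [add_mul, h7] at h8
    have h9 : γ * K * (4 * γ) ≤ γ * K * 4 := by
      apply mul_le_mul_of_nonneg_left _ (mul_nonneg hγ.le hK)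
      linarith
    nlinarith [mul_pos hγ (neg_pos.2 hneg)]
  have hcl : IsClosed {d | B.DecouplingBound lam z β d} := by
    simp only [DecouplingBound, Set.ofPred_forall]
    refine isClosed_iInter fun θ => isClosed_iInter fun γ => isClosed_iInter fun _ => ?_
    exact isClosed_le continuous_const (by fun_prop)
  have hb : BddBelow {d | B.DecouplingBound lam z β d} := ⟨0, fun d hd => h0 d hd⟩
  have hm : B.decouplingAt lam z β ∈ {d | B.DecouplingBound lam z β d} :=
    hcl.csInf_mem ⟨_, hT⟩ hb
  exact ⟨⟨hm, fun d hd => csInf_le hb hd⟩, h0 _ hm, csInf_le hb hT⟩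

/-- The supremum in the definition of `decoupling` is over a bounded set. -/
theorem decoupling_bddAbove (lam ε : ℝ) (hlam : 0 ≤ lam) :
    BddAbove {d | ∃ (z : Fin T → X × A) (β : Fin T → ℝ),
      (∀ t, 0 < β t ∧ β t ≤ ε) ∧ d = B.decouplingAt lam z β} := by
  refine ⟨T, ?_⟩
  rintro d ⟨z, β, hβ, rfl⟩
  exact (B.decouplingAt_isLeast lam hlam z β fun t => (hβ t).1).2.2

end BanditProblem

namespace Interaction

variable {Ω X A Θ : Type*} [MeasurableSpace Ω] [MeasurableSpace X] [MeasurableSpace A]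
  [MeasurableSpace Θ] {T : ℕ} (I : Interaction Ω X A Θ T) (B : BanditProblem X A Θ T)

/-- The σ-algebra generated by everything that happened strictly before round `t`. -/
abbrev past (t : Fin T) : MeasurableSpace Ω :=
  ⨆ s : Fin T, ⨆ _ : s < t,
    MeasurableSpace.comap (fun ω => (I.x s ω, I.θ s ω, I.a s ω, I.r s ω)) inferInstance

/-- The past together with the context of round `t`. -/
abbrev pastContext (t : Fin T) : MeasurableSpace Ω :=
  I.past t ⊔ MeasurableSpace.comap (I.x t) inferInstance

/-- All the randomness up to and including round `t` except the reward `r_t`. -/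
abbrev preReward (t : Fin T) : MeasurableSpace Ω :=
  I.past t ⊔ MeasurableSpace.comap (fun ω => (I.x t ω, I.θ t ω, I.a t ω)) inferInstance

/-- The noise `ε_t = r_t - f_*(x_t, a_t)`. -/
def noise (t : Fin T) (ω : Ω) : ℝ := I.r t ω - B.trueReward (I.x t ω) (I.a t ω)

/-- Conditionally on all the randomness before `r_t`, the noise `ε_t` is `σ_t²`-subgaussian:
`log E[exp(u ε_t) | 𝒢_t] ≤ σ_t² u² / 8` for all `u`. -/
def SubgaussianNoise (σ : Fin T → ℝ) : Prop :=
  ∀ (t : Fin T) (u : ℝ),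
    Integrable (fun ω => Real.exp (u * I.noise B t ω)) I.P ∧
    ∀ᵐ ω ∂I.P, (I.P[fun ω' => Real.exp (u * I.noise B t ω') | I.preReward t]) ω ≤
      Real.exp (σ t ^ 2 * u ^ 2 / 8)

/-- The posterior distribution of round `t`, as a measure on the function class:
`p_t(f) ∝ p_0(f) exp(-∑_{s<t} σ̄_s⁻² (r_s - f(x_s, a_s))² + λ_t max_{a ∈ A_t} f(x_t, a))`. -/
def posterior (α c : ℝ) (σ : Fin T → ℝ) (t : Fin T) (ω : Ω) : Measure Θ :=
  B.prior.tilted fun θ =>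
    -∑ s ∈ Finset.Iio t, (sigmaBar α σ s ^ 2)⁻¹ *
        (I.r s ω - B.reward θ (I.x s ω) (I.a s ω)) ^ 2
      + feelGoodWeight α c σ t * B.maxReward t θ (I.x t ω)

/-- The interaction is generated by the algorithm FGTS-VA with hyperparameters `α`, `c` and
revealed variance parameters `σ`. In round `t`, conditionally on the past and the context, `f_t` is
drawn from the posterior, and `a_t ∈ A_t` maximizes `f_t(x_t, ·)` over `A_t`. The contexts may
depend on the past in any way. -/
structure IsFGTSVA (α c : ℝ) (σ : Fin T → ℝ) : Prop where
  sample : ∀ (t : Fin T) (S : Set Θ), MeasurableSet S →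
    I.P[(I.θ t ⁻¹' S).indicator (fun _ => (1 : ℝ)) | I.pastContext t] =ᵐ[I.P]
      fun ω => (I.posterior B α c σ t ω).real S
  action_mem : ∀ t ω, I.a t ω ∈ B.actions t (I.x t ω)
  action_max : ∀ t ω, ∀ b ∈ B.actions t (I.x t ω),
    B.reward (I.θ t ω) (I.x t ω) b ≤ B.reward (I.θ t ω) (I.x t ω) (I.a t ω)

/-- `Z_t = -E log E_{f ∼ p_0} exp(-∑_{s<t} σ̄_s⁻² ΔL(f, x_s, a_s, r_s) + λ_t FG_t(f))`. -/
def roundPotential (α c : ℝ) (σ : Fin T → ℝ) (t : Fin T) : ℝ :=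
  -∫ ω, Real.log (∫ θ, Real.exp
      (-∑ s ∈ Finset.Iio t, (sigmaBar α σ s ^ 2)⁻¹ *
          B.deltaL θ (I.x s ω) (I.a s ω) (I.r s ω)
        + feelGoodWeight α c σ t * B.feelGood t θ (I.x t ω)) ∂B.prior) ∂I.P

/-- `E[Regret(T)]`, where `Regret(T) = ∑_t (max_{a ∈ A_t} f_*(x_t, a) - f_*(x_t, a_t))`. -/
def expectedRegret : ℝ :=
  ∫ ω, ∑ t, (B.maxReward t B.truth (I.x t ω) - B.trueReward (I.x t ω) (I.a t ω)) ∂I.P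

end Interaction

/-- `Z = 1 ∨ sup_σ max_t Z_t`, where `σ` ranges over the set `𝒮` of admissible variance sequences
and `Z_t` is computed for the interaction `run σ`; a priori `Z` may be infinite. -/
def potential {Ω X A Θ : Type*} [MeasurableSpace Ω] [MeasurableSpace X] [MeasurableSpace A]
    [MeasurableSpace Θ] {T : ℕ} (B : BanditProblem X A Θ T) (𝒮 : Set (Fin T → ℝ))
    (run : (Fin T → ℝ) → Interaction Ω X A Θ T) (α c : ℝ) : EReal :=
  max 1 (⨆ σ ∈ 𝒮, ⨆ t : Fin T, (((run σ).roundPotential B α c σ t : ℝ) : EReal))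

end

/-! The chosen action maximizes the sampled function, so the regret of a round equals the error
`gap` of `f_t` at `(x_t, a_t)` minus its feel-good term (`regret_eq`). The decoupling inequality
with weights `σ̄_t⁻²` trades the on-policy errors for squared errors `cumSqGap` on past data
(`expectedRegret_le_sum`).

Squared errors and feel-good terms are controlled together, round by round
(`integral_cumSqGap_sub_feelGood_le`). Let `N` be the normalizing constant of the posterior and `h`
half the squared error minus `λ_t` times the feel-good term, both for round `t`. Averaging `N * exp
h` over the posterior cancels `N` and the feel-good weight. What remains is a prior average of
exponential supermartingales for fixed functions, whose expectations are at most `1`. Then `log y ≤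
y - 1` gives `E h ≤ -E log N = Z_t`, a change-of-measure bound that never mentions relative entropy.

Dividing by `λ_t` and summing `σ̄_t² / √Λ_t` by telescoping bounds everything by multiples of `√L`,
where `L = ∑ σ̄_t² ≤ α² T + Λ`. The choice of `c` balances the two main terms, and `Z ≥ 1` absorbs
the third. -/

noncomputable section

/-! ### Conditioning: random subgaussian parameters and disintegration of the posterior -/

/-- A conditional subgaussian bound persists when the deterministic parameter of the moment
generating function is replaced by a random one that is measurable for the conditioning
σ-algebra. -/
theorem lintegral_mul_exp_le_of_condExp_le {Ω : Type*} {m m0 : MeasurableSpace Ω} (hm : m ≤ m0)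
    (μ : @Measure Ω m0) [IsProbabilityMeasure μ] {e : Ω → ℝ} (he : Measurable[m0] e) (v : ℝ)
    (h : ∀ u : ℝ, Integrable (fun ω => Real.exp (u * e ω)) μ ∧
      ∀ᵐ ω ∂μ, (μ[fun ω' => Real.exp (u * e ω') | m]) ω ≤ Real.exp (v * u ^ 2))
    {U : Ω → ℝ} (hU : Measurable[m] U) {W : Ω → ENNReal} (hW : Measurable[m] W) :
    ∫⁻ ω, W ω * ENNReal.ofReal (Real.exp (U ω * e ω - v * U ω ^ 2)) ∂μ ≤ ∫⁻ ω, W ω ∂μ := by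
  have hconst : ∀ (u : ℝ) (W' : Ω → ENNReal), Measurable[m] W' →
      ∫⁻ ω, W' ω * ENNReal.ofReal (Real.exp (u * e ω - v * u ^ 2)) ∂μ ≤ ∫⁻ ω, W' ω ∂μ := by
    intro u W' hW'
    set f : Ω → ENNReal := fun ω => ENNReal.ofReal (Real.exp (u * e ω - v * u ^ 2)) with hf
    have hfm : Measurable[m0] f := by fun_prop
    have hfi : Integrable (fun ω => Real.exp (u * e ω - v * u ^ 2)) μ := by
      simp_rw [Real.exp_sub]
      exact (h u).1.div_const _
    -- The conditional bound is a comparison of measures on `m`, so it can be integrated against any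
    -- `m`-measurable weight, with no integrability assumption on `W'`.
    have hle : (μ.withDensity f).trim hm ≤ μ.trim hm := by
      refine Measure.le_iff.2 fun E hE => ?_
      rw [trim_measurableSet_eq hm hE, trim_measurableSet_eq hm hE,
        withDensity_apply _ (hm E hE), hf, ← ofReal_integral_eq_lintegral_ofReal hfi.integrableOn
          (Filter.Eventually.of_forall fun _ => (Real.exp_pos _).le)]
      have h1 : ∫ ω in E, Real.exp (u * e ω - v * u ^ 2) ∂μ ≤ μ.real E := by
        simp_rw [Real.exp_sub]
        rw [integral_div, div_le_iff₀ (Real.exp_pos _), ← setIntegral_condExp hm (h u).1 hE]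
        refine (setIntegral_mono_ae integrable_condExp.integrableOn
          (integrableOn_const (by simp) (by simp)) (h u).2).trans ?_
        simp [mul_comm]
      refine (ENNReal.ofReal_le_ofReal h1).trans ?_
      simp
    calc ∫⁻ ω, W' ω * f ω ∂μ = ∫⁻ ω, W' ω ∂(μ.withDensity f) := by
          rw [lintegral_withDensity_eq_lintegral_mul _ hfm (hW'.mono hm le_rfl)]
          simp [mul_comm]
      _ = ∫⁻ ω, W' ω ∂((μ.withDensity f).trim hm) := (lintegral_trim hm hW').symm
      _ ≤ ∫⁻ ω, W' ω ∂(μ.trim hm) := lintegral_mono' hle le_rfl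
      _ = ∫⁻ ω, W' ω ∂μ := lintegral_trim hm hW'
  have hsimple : ∀ V : Ω → ℝ, Measurable[m] V → (Set.range V).Finite →
      ∫⁻ ω, W ω * ENNReal.ofReal (Real.exp (V ω * e ω - v * V ω ^ 2)) ∂μ ≤ ∫⁻ ω, W ω ∂μ := by
    intro V hVm hfin
    -- The fibres of `V` cut the space into finitely many `m`-measurable pieces, on each of which
    -- the parameter is constant.
    have hdec : ∀ (g : ℝ → Ω → ENNReal) (ω : Ω),
        ∑ u ∈ hfin.toFinset, (V ⁻¹' {u}).indicator (g u) ω = g (V ω) ω := by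
      intro g ω
      rw [Finset.sum_eq_single (V ω)]
      · simp
      · intro u _ hu
        simp [Set.indicator, hu.symm]
      · intro hV
        simp at hV
    have hms : ∀ u, MeasurableSet[m] (V ⁻¹' {u}) := fun u =>
      hVm (measurableSet_singleton u)
    calc ∫⁻ ω, W ω * ENNReal.ofReal (Real.exp (V ω * e ω - v * V ω ^ 2)) ∂μ
        = ∫⁻ ω, ∑ u ∈ hfin.toFinset, (V ⁻¹' {u}).indicator W ω *
            ENNReal.ofReal (Real.exp (u * e ω - v * u ^ 2)) ∂μ := by
          congr 1 with ω
          rw [← hdec (fun u ω => W ω * ENNReal.ofReal (Real.exp (u * e ω - v * u ^ 2))) ω]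
          refine Finset.sum_congr rfl fun u _ => ?_
          by_cases hu : ω ∈ V ⁻¹' {u} <;> simp [hu]
      _ = ∑ u ∈ hfin.toFinset, ∫⁻ ω, (V ⁻¹' {u}).indicator W ω *
            ENNReal.ofReal (Real.exp (u * e ω - v * u ^ 2)) ∂μ := by
          refine lintegral_finsetSum _ fun u _ => ?_
          have := (hW.indicator (hms u)).mono hm le_rfl
          fun_prop
      _ ≤ ∑ u ∈ hfin.toFinset, ∫⁻ ω, (V ⁻¹' {u}).indicator W ω ∂μ :=
          Finset.sum_le_sum fun u _ => hconst u _ (hW.indicator (hms u))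
      _ = ∫⁻ ω, ∑ u ∈ hfin.toFinset, (V ⁻¹' {u}).indicator W ω ∂μ :=
          (lintegral_finsetSum _ fun u _ => (hW.indicator (hms u)).mono hm le_rfl).symm
      _ = ∫⁻ ω, W ω ∂μ := by
          congr 1 with ω
          exact hdec (fun _ => W) ω
  have hUs : StronglyMeasurable[m] U := hU.stronglyMeasurable
  have hlim : ∀ ω, Filter.Tendsto (fun n => W ω * ENNReal.ofReal
      (Real.exp (hUs.approx n ω * e ω - v * hUs.approx n ω ^ 2))) Filter.atTop
      (nhds (W ω * ENNReal.ofReal (Real.exp (U ω * e ω - v * U ω ^ 2)))) := by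
    intro ω
    have h1 := hUs.tendsto_approx ω
    -- `W ω` may be infinite; the limit passes through the product because the exponential factor
    -- tends to a nonzero value.
    refine ENNReal.Tendsto.const_mul (ENNReal.tendsto_ofReal ?_) (Or.inl ?_)
    swap
    · exact (ENNReal.ofReal_pos.2 (Real.exp_pos _)).ne'
    exact (Real.continuous_exp.tendsto _).comp ((h1.mul_const _).sub ((h1.pow 2).const_mul _))
  calc ∫⁻ ω, W ω * ENNReal.ofReal (Real.exp (U ω * e ω - v * U ω ^ 2)) ∂μ
      = ∫⁻ ω, Filter.liminf (fun n => W ω * ENNReal.ofReal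
          (Real.exp (hUs.approx n ω * e ω - v * hUs.approx n ω ^ 2))) Filter.atTop ∂μ := by
        congr 1 with ω
        exact (hlim ω).liminf_eq.symm
    -- Fatou's lemma suffices, as only an upper bound is wanted.
    _ ≤ Filter.liminf (fun n => ∫⁻ ω, W ω * ENNReal.ofReal
          (Real.exp (hUs.approx n ω * e ω - v * hUs.approx n ω ^ 2)) ∂μ) Filter.atTop := by
        refine lintegral_liminf_le fun n => ?_
        have h1 := hW.mono hm le_rfl
        have h2 : Measurable[m0] (hUs.approx n) :=
          (@SimpleFunc.measurable _ _ m _ (hUs.approx n)).mono hm le_rfl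
        fun_prop
    _ ≤ ∫⁻ ω, W ω ∂μ :=
        Filter.liminf_le_of_le (by isBoundedDefault) fun b hb => by
          obtain ⟨n, hn⟩ := hb.exists
          exact hn.trans (hsimple _ (@SimpleFunc.measurable _ _ m _ (hUs.approx n))
            (@SimpleFunc.finite_range _ _ m (hUs.approx n)))

/-- If, given `x`, the random variable `y` is distributed according to an exponential tilt of `p`,
then expectations of functions of `(x, y)` are computed by integrating out `y` first. -/
theorem lintegral_prodMk_eq_of_tilted {Ω H Θ : Type*} [MeasurableSpace Ω] [MeasurableSpace H]
    [MeasurableSpace Θ] (μ : Measure Ω) [IsProbabilityMeasure μ] {x : Ω → H} (hx : Measurable x)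
    {y : Ω → Θ} (hy : Measurable y) (p : Measure Θ) [IsProbabilityMeasure p] {g : H × Θ → ℝ}
    (hg : Measurable g)
    (hlaw : ∀ E S, MeasurableSet E → MeasurableSet S → μ (x ⁻¹' E ∩ y ⁻¹' S) =
      ∫⁻ ω in x ⁻¹' E, (p.tilted fun θ => g (x ω, θ)) S ∂μ)
    {F : H × Θ → ENNReal} (hF : Measurable F) :
    ∫⁻ ω, F (x ω, y ω) ∂μ = ∫⁻ ω, ∫⁻ θ, F (x ω, θ) ∂(p.tilted fun θ => g (x ω, θ)) ∂μ := by
  have := Measure.isProbabilityMeasure_map (μ := μ) hx.aemeasurable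
  set D : H × Θ → ENNReal := fun q =>
    ENNReal.ofReal (Real.exp (g q) / ∫ θ, Real.exp (g (q.1, θ)) ∂p) with hD
  have hDm : Measurable D := by
    have h1 : StronglyMeasurable fun q : H × Θ => Real.exp (g q) := by
      exact (Real.measurable_exp.comp hg).stronglyMeasurable
    have h2 : Measurable fun h : H => ∫ θ, Real.exp (g (h, θ)) ∂p :=
      h1.integral_prod_right'.measurable
    exact (h1.measurable.div (h2.comp measurable_fst)).ennreal_ofReal
  have hinner : ∀ (G : Θ → ENNReal) (h : H), Measurable G →
      ∫⁻ θ, G θ ∂(p.tilted fun θ => g (h, θ)) = ∫⁻ θ, D (h, θ) * G θ ∂p := by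
    intro G h hG
    have : Measurable fun θ => D (h, θ) := hDm.comp measurable_prodMk_left
    exact lintegral_withDensity_eq_lintegral_mul _ this hG
  -- The joint law has density `D` with respect to the product of the law of `x` and `p`; it is
  -- enough to check this on rectangles.
  have key : μ.map (fun ω => (x ω, y ω)) = ((μ.map x).prod p).withDensity D := by
    have : IsProbabilityMeasure (μ.map fun ω => (x ω, y ω)) :=
      Measure.isProbabilityMeasure_map (hx.prodMk hy).aemeasurable
    have h1 : ∀ E S, MeasurableSet E → MeasurableSet S →
        μ.map (fun ω => (x ω, y ω)) (E ×ˢ S) = ((μ.map x).prod p).withDensity D (E ×ˢ S) := by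
      intro E S hE hS
      rw [Measure.map_apply (hx.prodMk hy) (hE.prod hS), withDensity_apply _ (hE.prod hS),
        setLIntegral_prod (μ := μ.map x) (ν := p) _ hDm.aemeasurable,
        setLIntegral_map hE (Measurable.lintegral_prod_right' (ν := p.restrict S) hDm) hx]
      rw [Set.mk_preimage_prod, hlaw E S hE hS]
      refine lintegral_congr fun ω => ?_
      exact withDensity_apply _ hS
    refine ext_of_generate_finite _ generateFrom_prod.symm isPiSystem_prod ?_ ?_
    · rintro _ ⟨E, hE, S, hS, rfl⟩
      exact h1 E S hE hS
    · simpa using h1 _ _ MeasurableSet.univ MeasurableSet.univ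
  calc ∫⁻ ω, F (x ω, y ω) ∂μ = ∫⁻ q, F q ∂(μ.map fun ω => (x ω, y ω)) :=
        (lintegral_map hF (hx.prodMk hy)).symm
    _ = ∫⁻ q, D q * F q ∂((μ.map x).prod p) := by
        rw [key]; exact lintegral_withDensity_eq_lintegral_mul _ hDm hF
    _ = ∫⁻ h, ∫⁻ θ, D (h, θ) * F (h, θ) ∂p ∂(μ.map x) :=
        lintegral_prod _ (hDm.mul hF).aemeasurable
    _ = ∫⁻ ω, ∫⁻ θ, D (x ω, θ) * F (x ω, θ) ∂p ∂μ :=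
        lintegral_map (hDm.mul hF).lintegral_prod_right' hx
    _ = _ := lintegral_congr fun ω => (hinner _ _ (hF.comp measurable_prodMk_left)).symm

/-! ### Bounds and measurability for gaps, loss differences and feel-good terms -/

namespace BanditProblem

variable {X A Θ : Type*} [MeasurableSpace X] [MeasurableSpace A] [MeasurableSpace Θ] {T : ℕ}
  (B : BanditProblem X A Θ T)

/-- The difference `f_θ(x, a) - f_*(x, a)`. -/
def gap (θ : Θ) (x : X) (a : A) : ℝ := B.reward θ x a - B.trueReward x a

theorem abs_gap_le_one (θ : Θ) (x : X) (a : A) : |B.gap θ x a| ≤ 1 := by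
  have h1 := B.reward_mem θ x a
  have h2 := B.reward_mem B.truth x a
  rw [gap, trueReward, abs_le]
  constructor <;> linarith [h1.1, h1.2, h2.1, h2.2]

theorem gap_sq_le_one (θ : Θ) (x : X) (a : A) : B.gap θ x a ^ 2 ≤ 1 :=
  (sq_le_one_iff_abs_le_one _).2 (B.abs_gap_le_one θ x a)

theorem deltaL_eq (θ : Θ) (x : X) (a : A) (r : ℝ) :
    B.deltaL θ x a r = B.gap θ x a ^ 2 - 2 * (r - B.trueReward x a) * B.gap θ x a := by
  simp only [deltaL, gap]
  ring

theorem abs_deltaL_le (θ : Θ) (x : X) (a : A) (r : ℝ) :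
    |B.deltaL θ x a r| ≤ 1 + 2 * |r - B.trueReward x a| := by
  rw [deltaL_eq]
  refine (abs_sub _ _).trans (add_le_add ?_ ?_)
  · rw [abs_of_nonneg (sq_nonneg _)]
    exact B.gap_sq_le_one θ x a
  · rw [abs_mul, abs_mul, abs_two]
    exact mul_le_of_le_one_right (by positivity) (B.abs_gap_le_one θ x a)

theorem maxReward_mem (t : Fin T) (θ : Θ) (x : X) : B.maxReward t θ x ∈ Set.Icc (0 : ℝ) 1 := by
  constructor
  · refine Real.sSup_nonneg ?_
    rintro _ ⟨a, -, rfl⟩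
    exact (B.reward_mem θ x a).1
  · refine Real.sSup_le ?_ zero_le_one
    rintro _ ⟨a, -, rfl⟩
    exact (B.reward_mem θ x a).2

theorem abs_feelGood_le_one (t : Fin T) (θ : Θ) (x : X) : |B.feelGood t θ x| ≤ 1 := by
  have h1 := B.maxReward_mem t θ x
  have h2 := B.maxReward_mem t B.truth x
  rw [feelGood, abs_le]
  constructor <;> linarith [h1.1, h1.2, h2.1, h2.2]

theorem maxReward_eq {t : Fin T} {θ : Θ} {x : X} {a : A} (ha : a ∈ B.actions t x)
    (hmax : ∀ b ∈ B.actions t x, B.reward θ x b ≤ B.reward θ x a) :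
    B.maxReward t θ x = B.reward θ x a := by
  refine IsGreatest.csSup_eq ⟨⟨a, ha, rfl⟩, ?_⟩
  rintro _ ⟨b, hb, rfl⟩
  exact hmax b hb

variable {Ω : Type*} [MeasurableSpace Ω]

theorem measurable_reward_comp {θ : Ω → Θ} {x : Ω → X} {a : Ω → A} (hθ : Measurable θ)
    (hx : Measurable x) (ha : Measurable a) :
    Measurable fun ω => B.reward (θ ω) (x ω) (a ω) :=
  B.measurable_reward.comp (hθ.prodMk (hx.prodMk ha))

theorem measurable_gap_comp {θ : Ω → Θ} {x : Ω → X} {a : Ω → A} (hθ : Measurable θ)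
    (hx : Measurable x) (ha : Measurable a) :
    Measurable fun ω => B.gap (θ ω) (x ω) (a ω) :=
  (B.measurable_reward_comp hθ hx ha).sub (B.measurable_reward_comp measurable_const hx ha)

theorem measurable_deltaL_comp {θ : Ω → Θ} {x : Ω → X} {a : Ω → A} {r : Ω → ℝ}
    (hθ : Measurable θ) (hx : Measurable x) (ha : Measurable a) (hr : Measurable r) :
    Measurable fun ω => B.deltaL (θ ω) (x ω) (a ω) (r ω) :=
  ((hr.sub (B.measurable_reward_comp hθ hx ha)).pow_const 2).sub
    ((hr.sub (B.measurable_reward_comp measurable_const hx ha)).pow_const 2)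

theorem measurable_maxReward_comp (t : Fin T) {θ : Ω → Θ} {x : Ω → X} (hθ : Measurable θ)
    (hx : Measurable x) : Measurable fun ω => B.maxReward t (θ ω) (x ω) :=
  (B.measurable_max t).comp (hθ.prodMk hx)

theorem measurable_feelGood_comp (t : Fin T) {θ : Ω → Θ} {x : Ω → X} (hθ : Measurable θ)
    (hx : Measurable x) : Measurable fun ω => B.feelGood t (θ ω) (x ω) :=
  (B.measurable_maxReward_comp t hθ hx).sub (B.measurable_maxReward_comp t measurable_const hx)

/-- The infimum in `decouplingAt` is attained, and the right-hand side increases with `d`.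
Boundedness of the set of coefficients makes the real `sSup` a genuine upper bound. -/
theorem decouplingBound_decoupling {lam ε : ℝ} (hlam : 0 ≤ lam) (z : Fin T → X × A)
    (β : Fin T → ℝ) (hβ : ∀ t, 0 < β t ∧ β t ≤ ε) :
    B.DecouplingBound lam z β (B.decoupling lam ε) := by
  intro θ γ hγ
  refine ((B.decouplingAt_isLeast lam hlam z β fun t => (hβ t).1).1.1 θ γ hγ).trans ?_
  gcongr
  exact le_csSup (B.decoupling_bddAbove lam ε hlam) ⟨z, β, hβ, rfl⟩

end BanditProblem

/-! ### Filtration, noise and posterior weights -/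

theorem sigmaBar_pos {T : ℕ} {α : ℝ} (hα : 0 < α) (σ : Fin T → ℝ) (t : Fin T) :
    0 < sigmaBar α σ t := lt_max_of_lt_right hα

namespace Interaction

variable {Ω X A Θ : Type*} [mΩ : MeasurableSpace Ω] [MeasurableSpace X] [MeasurableSpace A]
  [MeasurableSpace Θ] {T : ℕ} (I : Interaction Ω X A Θ T) (B : BanditProblem X A Θ T)

theorem past_le (t : Fin T) : I.past t ≤ mΩ :=
  iSup₂_le fun s _ => ((I.measurable_x s).prodMk ((I.measurable_θ s).prodMk
    ((I.measurable_a s).prodMk (I.measurable_r s)))).comap_le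

theorem pastContext_le (t : Fin T) : I.pastContext t ≤ mΩ :=
  sup_le (I.past_le t) (I.measurable_x t).comap_le

theorem preReward_le (t : Fin T) : I.preReward t ≤ mΩ :=
  sup_le (I.past_le t) ((I.measurable_x t).prodMk ((I.measurable_θ t).prodMk
    (I.measurable_a t))).comap_le

theorem measurable_past {s t : Fin T} (h : s < t) :
    Measurable[I.past t] fun ω => (I.x s ω, I.θ s ω, I.a s ω, I.r s ω) :=
  Measurable.of_comap_le (le_iSup₂_of_le s h le_rfl)

theorem measurable_preReward (t : Fin T) :
    Measurable[I.preReward t] fun ω => (I.x t ω, I.θ t ω, I.a t ω) :=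
  Measurable.of_comap_le le_sup_right

theorem measurable_pastContext (t : Fin T) : Measurable[I.pastContext t] (I.x t) :=
  Measurable.of_comap_le le_sup_right

theorem measurable_noise (t : Fin T) : Measurable (I.noise B t) :=
  (I.measurable_r t).sub
    (B.measurable_reward_comp measurable_const (I.measurable_x t) (I.measurable_a t))

variable {I B} in
-- The moment generating function at `±1` dominates: `|x| ≤ exp x + exp (-x)`.
theorem SubgaussianNoise.integrable_noise {σ : Fin T → ℝ} (h : I.SubgaussianNoise B σ)
    (t : Fin T) : Integrable (I.noise B t) I.P := by
  refine ((h t 1).1.add (h t (-1)).1).mono' (I.measurable_noise B t).aestronglyMeasurable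
    (Filter.Eventually.of_forall fun ω => ?_)
  simp only [Pi.add_apply, one_mul, neg_one_mul, Real.norm_eq_abs]
  rcases abs_cases (I.noise B t ω) with ⟨h1, -⟩ | ⟨h1, -⟩ <;> rw [h1]
  · linarith [Real.add_one_le_exp (I.noise B t ω), Real.exp_pos (-I.noise B t ω)]
  · linarith [Real.add_one_le_exp (-I.noise B t ω), Real.exp_pos (I.noise B t ω)]

/-- The weighted cumulative squared error `∑_{s<t} σ̄_s⁻² (f_θ(x_s, a_s) - f_*(x_s, a_s))²`. -/
def cumSqGap (α : ℝ) (σ : Fin T → ℝ) (t : Fin T) (θ : Θ) (ω : Ω) : ℝ :=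
  ∑ s ∈ Finset.Iio t, (sigmaBar α σ s ^ 2)⁻¹ * B.gap θ (I.x s ω) (I.a s ω) ^ 2

/-- The logarithm of the unnormalized posterior density of round `t`, relative to that of the true
reward function. -/
def logWeight (α c : ℝ) (σ : Fin T → ℝ) (t : Fin T) (θ : Θ) (ω : Ω) : ℝ :=
  -∑ s ∈ Finset.Iio t, (sigmaBar α σ s ^ 2)⁻¹ * B.deltaL θ (I.x s ω) (I.a s ω) (I.r s ω)
    + feelGoodWeight α c σ t * B.feelGood t θ (I.x t ω)

/-- Passing to losses and maxima relative to `f_*` changes the exponent by a constant `K`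
independent of `θ`, which normalization removes. -/
theorem posterior_eq (α c : ℝ) (σ : Fin T → ℝ) (t : Fin T) (ω : Ω) :
    I.posterior B α c σ t ω = B.prior.tilted fun θ => I.logWeight B α c σ t θ ω := by
  obtain ⟨K, hK⟩ : ∃ K : ℝ, ∀ θ, I.logWeight B α c σ t θ ω =
      (-∑ s ∈ Finset.Iio t, (sigmaBar α σ s ^ 2)⁻¹ *
        (I.r s ω - B.reward θ (I.x s ω) (I.a s ω)) ^ 2
      + feelGoodWeight α c σ t * B.maxReward t θ (I.x t ω)) + K := by
    refine ⟨∑ s ∈ Finset.Iio t, (sigmaBar α σ s ^ 2)⁻¹ *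
        (I.r s ω - B.trueReward (I.x s ω) (I.a s ω)) ^ 2
      - feelGoodWeight α c σ t * B.maxReward t B.truth (I.x t ω), fun θ => ?_⟩
    simp only [logWeight, BanditProblem.deltaL, BanditProblem.feelGood, mul_sub,
      Finset.sum_sub_distrib]
    ring
  simp only [posterior, Measure.tilted, hK]
  congr 1 with θ
  simp only [Real.exp_add _ K]
  rw [integral_mul_const, mul_div_mul_right _ _ (Real.exp_pos K).ne']

/-- Joint measurability is needed for the smaller σ-algebra, because the disintegration is applied
with `(Ω, pastContext)` as conditioning space. -/
theorem measurable_cumSqGap_pastContext (α : ℝ) (σ : Fin T → ℝ) (t : Fin T) :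
    @Measurable (Ω × Θ) ℝ (@Prod.instMeasurableSpace Ω Θ (I.pastContext t) _) _
      fun q => I.cumSqGap B α σ t q.2 q.1 := by
  have h := fun s (hs : s ∈ Finset.Iio t) => (I.measurable_past (Finset.mem_Iio.1 hs)).mono
    (le_sup_left : I.past t ≤ I.pastContext t) le_rfl
  let _ : MeasurableSpace Ω := I.pastContext t
  refine Finset.measurable_fun_sum _ fun s hs => ?_
  have h := h s hs
  exact ((B.measurable_gap_comp measurable_snd (h.fst.comp measurable_fst)
    (h.snd.snd.fst.comp measurable_fst)).pow_const 2).const_mul _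

theorem measurable_logWeight_pastContext (α c : ℝ) (σ : Fin T → ℝ) (t : Fin T) :
    @Measurable (Ω × Θ) ℝ (@Prod.instMeasurableSpace Ω Θ (I.pastContext t) _) _
      fun q => I.logWeight B α c σ t q.2 q.1 := by
  have h := fun s (hs : s ∈ Finset.Iio t) => (I.measurable_past (Finset.mem_Iio.1 hs)).mono
    (le_sup_left : I.past t ≤ I.pastContext t) le_rfl
  have hx := I.measurable_pastContext t
  let _ : MeasurableSpace Ω := I.pastContext t
  refine Measurable.add (Measurable.neg ?_) ?_
  · refine Finset.measurable_fun_sum _ fun s hs => ?_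
    have h := h s hs
    exact (B.measurable_deltaL_comp measurable_snd (h.fst.comp measurable_fst)
      (h.snd.snd.fst.comp measurable_fst) (h.snd.snd.snd.comp measurable_fst)).const_mul _
  · exact (B.measurable_feelGood_comp t measurable_snd
      (hx.comp measurable_fst)).const_mul _

theorem measurable_feelGood_pastContext (t : Fin T) :
    @Measurable (Ω × Θ) ℝ (@Prod.instMeasurableSpace Ω Θ (I.pastContext t) _) _
      fun q => B.feelGood t q.2 (I.x t q.1) := by
  have hx := I.measurable_pastContext t
  let _ : MeasurableSpace Ω := I.pastContext t
  exact B.measurable_feelGood_comp t measurable_snd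
      (hx.comp measurable_fst)

theorem prod_pastContext_le (t : Fin T) :
    @Prod.instMeasurableSpace Ω Θ (I.pastContext t) _ ≤ Prod.instMeasurableSpace :=
  sup_le_sup (MeasurableSpace.comap_mono (I.pastContext_le t)) le_rfl

theorem cumSqGap_nonneg {α : ℝ} (σ : Fin T → ℝ) (t : Fin T) (θ : Θ) (ω : Ω) :
    0 ≤ I.cumSqGap B α σ t θ ω :=
  Finset.sum_nonneg fun _ _ => mul_nonneg (by positivity) (sq_nonneg _)

theorem cumSqGap_le {α : ℝ} (σ : Fin T → ℝ) (t : Fin T) (θ : Θ) (ω : Ω) :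
    I.cumSqGap B α σ t θ ω ≤ ∑ s ∈ Finset.Iio t, (sigmaBar α σ s ^ 2)⁻¹ :=
  Finset.sum_le_sum fun _ _ => mul_le_of_le_one_right (by positivity) (B.gap_sq_le_one _ _ _)

theorem abs_logWeight_le (α c : ℝ) (σ : Fin T → ℝ) (t : Fin T) (θ : Θ) (ω : Ω) :
    |I.logWeight B α c σ t θ ω| ≤
      ∑ s ∈ Finset.Iio t, (sigmaBar α σ s ^ 2)⁻¹ * (1 + 2 * |I.noise B s ω|)
        + |feelGoodWeight α c σ t| := by
  refine (abs_add_le _ _).trans (add_le_add ?_ ?_)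
  · rw [abs_neg]
    refine (Finset.abs_sum_le_sum_abs _ _).trans (Finset.sum_le_sum fun s _ => ?_)
    rw [abs_mul, abs_of_nonneg (by positivity : 0 ≤ (sigmaBar α σ s ^ 2)⁻¹)]
    exact mul_le_mul_of_nonneg_left (B.abs_deltaL_le _ _ _ _) (by positivity)
  · rw [abs_mul]
    exact mul_le_of_le_one_right (abs_nonneg _) (B.abs_feelGood_le_one _ _ _)

/-! ### The exponential supermartingale -/

/-- For a fixed function, the exponentiated and compensated loss differences form a
supermartingale started at `1`. -/
theorem lintegral_exp_sum_le_one {α : ℝ} (hα : 0 < α) {σ : Fin T → ℝ} (hσ : ∀ t, 0 ≤ σ t)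
    (hnoise : I.SubgaussianNoise B σ) (θ : Θ) (k : ℕ) :
    ∫⁻ ω, ENNReal.ofReal (Real.exp (∑ s : Fin T with s.val < k,
      (sigmaBar α σ s ^ 2)⁻¹ * (B.gap θ (I.x s ω) (I.a s ω) ^ 2 / 2 -
        B.deltaL θ (I.x s ω) (I.a s ω) (I.r s ω)))) ∂I.P ≤ 1 := by
  have := I.P_prob
  induction k with
  | zero => simp
  | succ k ih =>
    by_cases hk : k < T
    swap
    · have : (Finset.univ.filter fun s : Fin T => s.val < k + 1) =
          Finset.univ.filter fun s : Fin T => s.val < k := by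
        ext s
        have := s.isLt
        simp only [Finset.mem_filter, Finset.mem_univ, true_and]
        omega
      rwa [this]
    set t : Fin T := ⟨k, hk⟩ with ht
    have hins : (Finset.univ.filter fun s : Fin T => s.val < k + 1) =
        insert t (Finset.univ.filter fun s : Fin T => s.val < k) := by
      ext s
      simp only [Finset.mem_filter, Finset.mem_univ, true_and, Finset.mem_insert, Fin.ext_iff, ht]
      omega
    rw [hins]
    set b := (sigmaBar α σ t ^ 2)⁻¹ with hb
    have hbpos : 0 < b := inv_pos.2 (pow_pos (sigmaBar_pos hα σ t) 2)
    -- Since `ΔL = gap² - 2 ε gap`, the new factor is `exp (2 b ε gap - b gap² / 2)`. With `U = 2 b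
    -- gap` the subgaussian compensator is `σ² U² / 8 = σ² b² gap² / 2`, at most `b gap² / 2`
    -- because `σ̄ ≥ σ`.
    have hbσ : σ t ^ 2 * b ≤ 1 := by
      rw [hb, ← div_eq_mul_inv, div_le_one (pow_pos (sigmaBar_pos hα σ t) 2)]
      exact pow_le_pow_left₀ (hσ t) (le_max_left _ _) 2
    have hpre := I.measurable_preReward t
    have hgap : Measurable[I.preReward t] fun ω => B.gap θ (I.x t ω) (I.a t ω) :=
      @BanditProblem.measurable_gap_comp _ _ _ _ _ _ _ B _ (I.preReward t) _ _ _
        measurable_const hpre.fst hpre.snd.snd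
    have hW : Measurable[I.preReward t] fun ω => ENNReal.ofReal (Real.exp
        (∑ s : Fin T with s.val < k, (sigmaBar α σ s ^ 2)⁻¹ *
          (B.gap θ (I.x s ω) (I.a s ω) ^ 2 / 2 -
            B.deltaL θ (I.x s ω) (I.a s ω) (I.r s ω)))) := by
      have h := fun (s : Fin T) (hs : s ∈ Finset.univ.filter fun s : Fin T => s.val < k) =>
        (I.measurable_past (t := t) (s := s) (by simpa [Fin.lt_def, ht] using hs)).mono
          (le_sup_left : I.past t ≤ I.preReward t) le_rfl
      let _ : MeasurableSpace Ω := I.preReward t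
      refine (Real.measurable_exp.comp (Finset.measurable_fun_sum _ fun s hs => ?_)).ennreal_ofReal
      have h := h s hs
      exact (((B.measurable_gap_comp measurable_const h.fst h.snd.snd.fst).pow_const 2).div_const 2
        |>.sub (B.measurable_deltaL_comp measurable_const h.fst h.snd.snd.fst
          h.snd.snd.snd)).const_mul _
    refine le_trans ?_ ((lintegral_mul_exp_le_of_condExp_le (I.preReward_le t) I.P
      (I.measurable_noise B t) (σ t ^ 2 / 8) (fun u => ⟨(hnoise t u).1, ?_⟩)
      (hgap.const_mul (2 * b)) hW).trans ih)
    · refine lintegral_mono fun ω => ?_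
      rw [Finset.sum_insert (by simp [ht]), add_comm, Real.exp_add,
        ENNReal.ofReal_mul (Real.exp_pos _).le]
      refine mul_le_mul_right (ENNReal.ofReal_le_ofReal (Real.exp_le_exp.2 ?_)) _
      rw [B.deltaL_eq, noise, ← hb]
      nlinarith [mul_le_mul_of_nonneg_right hbσ
        (mul_nonneg hbpos.le (sq_nonneg (B.gap θ (I.x t ω) (I.a t ω))))]
    · filter_upwards [(hnoise t u).2] with ω h
      rwa [div_mul_eq_mul_div]

/-! ### Normalizing constant and change of measure in one round -/

theorem measurable_cumSqGap (α : ℝ) (σ : Fin T → ℝ) (t : Fin T) :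
    Measurable fun ω => I.cumSqGap B α σ t (I.θ t ω) ω :=
  Finset.measurable_fun_sum _ fun s _ => ((B.measurable_gap_comp (I.measurable_θ t)
    (I.measurable_x s) (I.measurable_a s)).pow_const 2).const_mul _

theorem integrable_cumSqGap (α : ℝ) (σ : Fin T → ℝ) (t : Fin T) :
    Integrable (fun ω => I.cumSqGap B α σ t (I.θ t ω) ω) I.P := by
  have := I.P_prob
  refine Integrable.of_bound (I.measurable_cumSqGap B α σ t).aestronglyMeasurable
    (∑ s ∈ Finset.Iio t, (sigmaBar α σ s ^ 2)⁻¹) (Filter.Eventually.of_forall fun ω => ?_)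
  rw [Real.norm_of_nonneg (I.cumSqGap_nonneg B _ _ _ _)]
  exact I.cumSqGap_le B _ _ _ _

theorem integrable_feelGood (t : Fin T) :
    Integrable (fun ω => B.feelGood t (I.θ t ω) (I.x t ω)) I.P := by
  have := I.P_prob
  exact Integrable.of_bound (B.measurable_feelGood_comp t (I.measurable_θ t)
    (I.measurable_x t)).aestronglyMeasurable 1
    (Filter.Eventually.of_forall fun ω => B.abs_feelGood_le_one _ _ _)

/-- The normalizing constant of the posterior of round `t`. -/
def partition (α c : ℝ) (σ : Fin T → ℝ) (t : Fin T) (ω : Ω) : ℝ :=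
  ∫ θ, Real.exp (I.logWeight B α c σ t θ ω) ∂B.prior

theorem roundPotential_eq (α c : ℝ) (σ : Fin T → ℝ) (t : Fin T) :
    I.roundPotential B α c σ t = -∫ ω, Real.log (I.partition B α c σ t ω) ∂I.P := rfl

theorem measurable_partition_pastContext (α c : ℝ) (σ : Fin T → ℝ) (t : Fin T) :
    Measurable[I.pastContext t] (I.partition B α c σ t) := by
  have := B.prior_prob
  have h := I.measurable_logWeight_pastContext B α c σ t
  let _ : MeasurableSpace Ω := I.pastContext t
  exact (Real.measurable_exp.comp h).stronglyMeasurable.integral_prod_right'.measurable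

theorem integrable_exp_logWeight (α c : ℝ) (σ : Fin T → ℝ) (t : Fin T) (ω : Ω) :
    Integrable (fun θ => Real.exp (I.logWeight B α c σ t θ ω)) B.prior := by
  have := B.prior_prob
  refine Integrable.of_bound (C := Real.exp (∑ s ∈ Finset.Iio t, (sigmaBar α σ s ^ 2)⁻¹ *
    (1 + 2 * |I.noise B s ω|) + |feelGoodWeight α c σ t|))
    (Real.measurable_exp.comp (((I.measurable_logWeight_pastContext B α c σ t).mono
      (I.prod_pastContext_le t) le_rfl).comp measurable_prodMk_left)).aestronglyMeasurable
    (Filter.Eventually.of_forall fun θ => ?_)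
  rw [Real.norm_of_nonneg (Real.exp_pos _).le]
  exact Real.exp_le_exp.2 ((le_abs_self _).trans (I.abs_logWeight_le B α c σ t θ ω))

theorem partition_pos (α c : ℝ) (σ : Fin T → ℝ) (t : Fin T) (ω : Ω) :
    0 < I.partition B α c σ t ω := by
  have := B.prior_prob
  exact integral_exp_pos (I.integrable_exp_logWeight B α c σ t ω)

theorem abs_log_partition_le (α c : ℝ) (σ : Fin T → ℝ) (t : Fin T) (ω : Ω) :
    |Real.log (I.partition B α c σ t ω)| ≤
      ∑ s ∈ Finset.Iio t, (sigmaBar α σ s ^ 2)⁻¹ * (1 + 2 * |I.noise B s ω|)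
        + |feelGoodWeight α c σ t| := by
  have := B.prior_prob
  have hpos := I.partition_pos B α c σ t ω
  have hint := I.integrable_exp_logWeight B α c σ t ω
  set K := ∑ s ∈ Finset.Iio t, (sigmaBar α σ s ^ 2)⁻¹ * (1 + 2 * |I.noise B s ω|)
        + |feelGoodWeight α c σ t|
  have hK : ∀ θ, |I.logWeight B α c σ t θ ω| ≤ K := fun θ => I.abs_logWeight_le B α c σ t θ ω
  rw [abs_le]
  constructor
  · rw [Real.le_log_iff_exp_le hpos]
    have := integral_mono (integrable_const (μ := B.prior) (Real.exp (-K))) hint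
      fun θ => Real.exp_le_exp.2 (abs_le.1 (hK θ)).1
    simpa [partition] using this
  · rw [Real.log_le_iff_le_exp hpos]
    have := integral_mono hint (integrable_const (μ := B.prior) (Real.exp K))
      fun θ => Real.exp_le_exp.2 (abs_le.1 (hK θ)).2
    simpa [partition] using this

/-- This makes `roundPotential` a genuine expectation instead of the default value `0`: the
logarithm is bounded by an affine function of the past `|ε_s|`. -/
theorem integrable_log_partition (α c : ℝ) {σ : Fin T → ℝ} (hnoise : I.SubgaussianNoise B σ)
    (t : Fin T) : Integrable (fun ω => Real.log (I.partition B α c σ t ω)) I.P := by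
  have := I.P_prob
  have hK : Integrable (fun ω => ∑ s ∈ Finset.Iio t, (sigmaBar α σ s ^ 2)⁻¹ *
      (1 + 2 * |I.noise B s ω|) + |feelGoodWeight α c σ t|) I.P := by
    refine Integrable.add (integrable_finsetSum _ fun s _ => ?_) (integrable_const _)
    exact ((integrable_const _).add ((hnoise.integrable_noise s).abs.const_mul 2)).const_mul _
  exact hK.mono' (Real.measurable_log.comp ((I.measurable_partition_pastContext B α c σ t).mono
    (I.pastContext_le t) le_rfl)).aestronglyMeasurable
    (Filter.Eventually.of_forall fun ω => I.abs_log_partition_le B α c σ t ω)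

variable {I B} in
-- The sampling rule, stated through conditional expectations of indicators, in the form required by
-- `lintegral_prodMk_eq_of_tilted`.
theorem IsFGTSVA.measure_inter {α c : ℝ} {σ : Fin T → ℝ} (h : I.IsFGTSVA B α c σ) (t : Fin T)
    {E : Set Ω} (hE : MeasurableSet[I.pastContext t] E) {S : Set Θ} (hS : MeasurableSet S) :
    I.P (E ∩ I.θ t ⁻¹' S) =
      ∫⁻ ω in E, (B.prior.tilted fun θ => I.logWeight B α c σ t θ ω) S ∂I.P := by
  have := I.P_prob
  have := B.prior_prob
  have hθS := I.measurable_θ t hS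
  have hprob : ∀ ω, IsProbabilityMeasure (B.prior.tilted fun θ => I.logWeight B α c σ t θ ω) :=
    fun ω => isProbabilityMeasure_tilted (I.integrable_exp_logWeight B α c σ t ω)
  have hsample := h.sample t S hS
  simp only [I.posterior_eq B] at hsample
  have hint : Integrable (fun ω =>
      (B.prior.tilted fun θ => I.logWeight B α c σ t θ ω).real S) I.P :=
    (integrable_congr hsample).1 integrable_condExp
  calc I.P (E ∩ I.θ t ⁻¹' S)
      = ENNReal.ofReal (∫ ω in E, (I.θ t ⁻¹' S).indicator (fun _ => (1 : ℝ)) ω ∂I.P) := by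
        rw [integral_indicator_const _ hθS, measureReal_restrict_apply hθS, Set.inter_comm]
        simp
    _ = ENNReal.ofReal (∫ ω in E,
          (B.prior.tilted fun θ => I.logWeight B α c σ t θ ω).real S ∂I.P) := by
        rw [← setIntegral_condExp (I.pastContext_le t)
          ((integrable_const (1 : ℝ)).indicator hθS) hE]
        congr 1
        exact integral_congr_ae (ae_restrict_of_ae hsample)
    _ = ∫⁻ ω in E, (B.prior.tilted fun θ => I.logWeight B α c σ t θ ω) S ∂I.P := by
        rw [ofReal_integral_eq_lintegral_ofReal hint.integrableOn
          (Filter.Eventually.of_forall fun _ => measureReal_nonneg)]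
        simp

/-- Averaging over the posterior replaces the factor `partition` by the unnormalized weight, leaving
an average over the prior. The prior does not depend on the data, so Tonelli reduces the claim to
one fixed function at a time. -/
theorem lintegral_partition_mul_exp_le_one {α c : ℝ} (hα : 0 < α) {σ : Fin T → ℝ}
    (hσ : ∀ t, 0 ≤ σ t) (hI : I.IsFGTSVA B α c σ) (hnoise : I.SubgaussianNoise B σ) (t : Fin T) :
    ∫⁻ ω, ENNReal.ofReal (I.partition B α c σ t ω *
      Real.exp (I.cumSqGap B α σ t (I.θ t ω) ω / 2 -
        feelGoodWeight α c σ t * B.feelGood t (I.θ t ω) (I.x t ω))) ∂I.P ≤ 1 := by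
  have := I.P_prob
  have := B.prior_prob
  set F : Ω × Θ → ENNReal := fun q => ENNReal.ofReal (I.partition B α c σ t q.1 *
      Real.exp (I.cumSqGap B α σ t q.2 q.1 / 2 -
        feelGoodWeight α c σ t * B.feelGood t q.2 (I.x t q.1))) with hFdef
  have hw := I.measurable_logWeight_pastContext B α c σ t
  have hF : @Measurable _ _ (@Prod.instMeasurableSpace Ω Θ (I.pastContext t) _) _ F := by
    have h1 := I.measurable_cumSqGap_pastContext B α σ t
    have h2 := I.measurable_feelGood_pastContext B t
    have h3 := I.measurable_partition_pastContext B α c σ t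
    let _ : MeasurableSpace Ω := I.pastContext t
    exact ((h3.comp measurable_fst).mul (Real.measurable_exp.comp
      ((h1.div_const 2).sub (h2.const_mul _)))).ennreal_ofReal
  -- Conditioning on a σ-algebra: the conditioning variable is the identity from `Ω` to `Ω` with the
  -- σ-algebra `pastContext`.
  have key := @lintegral_prodMk_eq_of_tilted Ω Ω Θ mΩ (I.pastContext t) _ I.P _ id
    (measurable_id'' (I.pastContext_le t)) (I.θ t) (I.measurable_θ t) B.prior _
    (fun q => I.logWeight B α c σ t q.2 q.1) hw (fun E S hE hS => hI.measure_inter t hE hS) F hF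
  simp only [id] at key
  -- The feel-good terms cancel, leaving exactly the exponent of the supermartingale.
  have hexp : ∀ θ ω, I.logWeight B α c σ t θ ω + (I.cumSqGap B α σ t θ ω / 2 -
      feelGoodWeight α c σ t * B.feelGood t θ (I.x t ω)) =
      ∑ s : Fin T with s.val < t.val, (sigmaBar α σ s ^ 2)⁻¹ *
        (B.gap θ (I.x s ω) (I.a s ω) ^ 2 / 2 - B.deltaL θ (I.x s ω) (I.a s ω) (I.r s ω)) := by
    intro θ ω
    have hIio : (Finset.univ.filter fun s : Fin T => s.val < t.val) = Finset.Iio t := by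
      ext s
      simp only [Finset.mem_filter, Finset.mem_univ, true_and, Finset.mem_Iio, Fin.lt_def]
    rw [hIio]
    simp only [logWeight, cumSqGap, mul_sub, Finset.sum_sub_distrib, mul_div_assoc',
      ← Finset.sum_div]
    ring
  have hinner : ∀ ω, ∫⁻ θ, F (ω, θ) ∂(B.prior.tilted fun θ => I.logWeight B α c σ t θ ω) =
      ∫⁻ θ, ENNReal.ofReal (Real.exp (∑ s : Fin T with s.val < t.val, (sigmaBar α σ s ^ 2)⁻¹ *
        (B.gap θ (I.x s ω) (I.a s ω) ^ 2 / 2 -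
          B.deltaL θ (I.x s ω) (I.a s ω) (I.r s ω)))) ∂B.prior := by
    intro ω
    rw [lintegral_tilted]
    refine lintegral_congr fun θ => ?_
    have hN := I.partition_pos B α c σ t ω
    rw [hFdef, ← ENNReal.ofReal_mul (by positivity), ← hexp, Real.exp_add]
    congr 1
    change _ / I.partition B α c σ t ω * _ = _
    field_simp
  calc ∫⁻ ω, F (ω, I.θ t ω) ∂I.P
      = ∫⁻ ω, ∫⁻ θ, ENNReal.ofReal (Real.exp (∑ s : Fin T with s.val < t.val,
        (sigmaBar α σ s ^ 2)⁻¹ * (B.gap θ (I.x s ω) (I.a s ω) ^ 2 / 2 -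
          B.deltaL θ (I.x s ω) (I.a s ω) (I.r s ω)))) ∂B.prior ∂I.P := by
        rw [key]
        exact lintegral_congr hinner
    _ = ∫⁻ θ, ∫⁻ ω, ENNReal.ofReal (Real.exp (∑ s : Fin T with s.val < t.val,
        (sigmaBar α σ s ^ 2)⁻¹ * (B.gap θ (I.x s ω) (I.a s ω) ^ 2 / 2 -
          B.deltaL θ (I.x s ω) (I.a s ω) (I.r s ω)))) ∂I.P ∂B.prior := by
        refine lintegral_lintegral_swap (Measurable.aemeasurable ?_)
        refine (Real.measurable_exp.comp
          (Finset.measurable_fun_sum _ fun s _ => ?_)).ennreal_ofReal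
        have hx : Measurable fun q : Ω × Θ => I.x s q.1 := (I.measurable_x s).comp measurable_fst
        have ha : Measurable fun q : Ω × Θ => I.a s q.1 := (I.measurable_a s).comp measurable_fst
        have hr : Measurable fun q : Ω × Θ => I.r s q.1 := (I.measurable_r s).comp measurable_fst
        exact (((B.measurable_gap_comp measurable_snd hx ha).pow_const 2).div_const 2
          |>.sub (B.measurable_deltaL_comp measurable_snd hx ha hr)).const_mul _
    _ ≤ ∫⁻ θ, 1 ∂B.prior :=
        lintegral_mono fun θ => I.lintegral_exp_sum_le_one B hα hσ hnoise θ t.val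
    _ = 1 := by simp

/-- The expected squared error of the sampled function on past data, minus its weighted feel-good
term, is controlled by the potential of the round. -/
theorem integral_cumSqGap_sub_feelGood_le {α c : ℝ} (hα : 0 < α) {σ : Fin T → ℝ}
    (hσ : ∀ t, 0 ≤ σ t) (hI : I.IsFGTSVA B α c σ) (hnoise : I.SubgaussianNoise B σ) (t : Fin T) :
    (∫ ω, I.cumSqGap B α σ t (I.θ t ω) ω ∂I.P) / 2 -
      feelGoodWeight α c σ t * ∫ ω, B.feelGood t (I.θ t ω) (I.x t ω) ∂I.P ≤
      I.roundPotential B α c σ t := by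
  have := I.P_prob
  set h : Ω → ℝ := fun ω => I.cumSqGap B α σ t (I.θ t ω) ω / 2 -
        feelGoodWeight α c σ t * B.feelGood t (I.θ t ω) (I.x t ω) with hdef
  have hsq := (I.integrable_cumSqGap B α σ t).div_const 2
  have hfg := (I.integrable_feelGood B t).const_mul (feelGoodWeight α c σ t)
  have hint : Integrable h I.P := hsq.sub hfg
  have hle := I.lintegral_partition_mul_exp_le_one B hα hσ hI hnoise t
  have hpos : ∀ ω, 0 < I.partition B α c σ t ω * Real.exp (h ω) := fun ω =>
    mul_pos (I.partition_pos B α c σ t ω) (Real.exp_pos _)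
  have hNm := (I.measurable_partition_pastContext B α c σ t).mono (I.pastContext_le t) le_rfl
  have hmeas : AEStronglyMeasurable (fun ω => I.partition B α c σ t ω * Real.exp (h ω)) I.P :=
    hNm.aestronglyMeasurable.mul
      (Real.continuous_exp.comp_aestronglyMeasurable hint.aestronglyMeasurable)
  have hNe : Integrable (fun ω => I.partition B α c σ t ω * Real.exp (h ω)) I.P := by
    refine ⟨hmeas, ?_⟩
    rw [hasFiniteIntegral_iff_ofReal (Filter.Eventually.of_forall fun ω => (hpos ω).le)]
    exact hle.trans_lt ENNReal.one_lt_top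
  have hNe1 : ∫ ω, I.partition B α c σ t ω * Real.exp (h ω) ∂I.P ≤ 1 := by
    rw [integral_eq_lintegral_of_nonneg_ae (Filter.Eventually.of_forall fun ω => (hpos ω).le) hmeas]
    exact ENNReal.toReal_le_of_le_ofReal zero_le_one (by simpa using hle)
  have hlog := I.integrable_log_partition B α c hnoise t
  -- `log (N exp h) ≤ N exp h - 1`, and the right-hand side has nonpositive expectation.
  have hmono := integral_mono (hlog.add hint) (hNe.sub (integrable_const 1)) fun ω => by
    have h1 := Real.log_le_sub_one_of_pos (hpos ω)
    rwa [Real.log_mul (I.partition_pos B α c σ t ω).ne' (Real.exp_pos _).ne', Real.log_exp] at h1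
  rw [integral_add' hlog hint, integral_sub' hNe (integrable_const 1)] at hmono
  have hh : ∫ ω, h ω ∂I.P = (∫ ω, I.cumSqGap B α σ t (I.θ t ω) ω ∂I.P) / 2 -
      feelGoodWeight α c σ t * ∫ ω, B.feelGood t (I.θ t ω) (I.x t ω) ∂I.P := by
    rw [hdef, integral_sub hsq hfg, integral_div, integral_const_mul]
  rw [roundPotential_eq, ← hh]
  simp only [integral_const, probReal_univ, smul_eq_mul, mul_one] at hmono
  linarith

/-- The regret of a round splits into the estimation error of the sampled function at the chosen
action and the feel-good term. -/
theorem IsFGTSVA.regret_eq {I : Interaction Ω X A Θ T} {B : BanditProblem X A Θ T} {α c : ℝ}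
    {σ : Fin T → ℝ} (h : I.IsFGTSVA B α c σ) (t : Fin T) (ω : Ω) :
    B.maxReward t B.truth (I.x t ω) - B.trueReward (I.x t ω) (I.a t ω) =
      B.gap (I.θ t ω) (I.x t ω) (I.a t ω) - B.feelGood t (I.θ t ω) (I.x t ω) := by
  rw [BanditProblem.feelGood, B.maxReward_eq (h.action_mem t ω) (h.action_max t ω),
    BanditProblem.gap]
  ring

end Interaction

/-! ### Sums of the weights and the final constant -/

theorem LambdaBar_pos {T : ℕ} {α : ℝ} (hα : 0 < α) (σ : Fin T → ℝ) (t : Fin T) :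
    0 < LambdaBar α σ t :=
  Finset.sum_pos (fun s _ => pow_pos (sigmaBar_pos hα σ s) 2) ⟨t, by simp⟩

theorem LambdaBar_le_sum {T : ℕ} (α : ℝ) (σ : Fin T → ℝ) (t : Fin T) :
    LambdaBar α σ t ≤ ∑ s, sigmaBar α σ s ^ 2 :=
  Finset.sum_le_sum_of_subset_of_nonneg (Finset.subset_univ _) fun _ _ _ => sq_nonneg _

theorem sum_sigmaBar_sq_le {T : ℕ} (α : ℝ) (σ : Fin T → ℝ) :
    ∑ t, sigmaBar α σ t ^ 2 ≤ α ^ 2 * T + ∑ t, σ t ^ 2 := by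
  have h : ∀ t, sigmaBar α σ t ^ 2 ≤ α ^ 2 + σ t ^ 2 := fun t => by
    rcases max_cases (σ t) α with ⟨h, -⟩ | ⟨h, -⟩ <;> rw [sigmaBar, h] <;>
      nlinarith [sq_nonneg (σ t), sq_nonneg α]
  refine (Finset.sum_le_sum fun t _ => h t).trans ?_
  simp [Finset.sum_add_distrib, mul_comm]

/-- `∑_t b_t / √(b_1 + ⋯ + b_t) ≤ 2 √(b_1 + ⋯ + b_T)`. -/
theorem sum_div_sqrt_sum_Iic_le {T : ℕ} {b : Fin T → ℝ} (hb : ∀ t, 0 < b t) :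
    ∑ t, b t / √(∑ s ∈ Finset.Iic t, b s) ≤ 2 * √(∑ t, b t) := by
  have key : ∀ k ≤ T, ∑ t : Fin T with t.val < k, b t / √(∑ s ∈ Finset.Iic t, b s) ≤
      2 * √(∑ t : Fin T with t.val < k, b t) := by
    intro k
    induction k with
    | zero => simp
    | succ k ih =>
      intro hk
      set t : Fin T := ⟨k, hk⟩ with ht
      have hins : (Finset.univ.filter fun s : Fin T => s.val < k + 1) =
          insert t (Finset.univ.filter fun s : Fin T => s.val < k) := by
        ext s
        simp only [Finset.mem_filter, Finset.mem_univ, true_and, Finset.mem_insert, Fin.ext_iff, ht]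
        omega
      have hIic : Finset.Iic t = insert t (Finset.univ.filter fun s : Fin T => s.val < k) := by
        rw [← hins]
        ext s
        simp only [Finset.mem_filter, Finset.mem_univ, true_and, Finset.mem_Iic, Fin.le_def, ht]
        omega
      have hnot : t ∉ Finset.univ.filter fun s : Fin T => s.val < k := by simp [ht]
      rw [hins, Finset.sum_insert hnot, hIic, Finset.sum_insert hnot]
      set S := ∑ s : Fin T with s.val < k, b s
      have hS : 0 ≤ S := Finset.sum_nonneg fun s _ => (hb s).le
      have hpos : 0 < √(b t + S) := Real.sqrt_pos.2 (by linarith [hb t])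
      -- The telescoping step; cleared of denominators it is `(√(b t + S) - √S)² ≥ 0`.
      have h1 : b t / √(b t + S) ≤ 2 * √(b t + S) - 2 * √S := by
        rw [div_le_iff₀ hpos]
        nlinarith [Real.sq_sqrt hS, Real.sq_sqrt (by linarith [hb t] : 0 ≤ b t + S),
          sq_nonneg (√(b t + S) - √S)]
      linarith [ih (by omega)]
  simpa using key T le_rfl

/-- The choice of `c` makes the first and third terms both equal to `√(L Z d)`. The middle one is
`√(L d / Z) / 4`, at most a quarter of that because `Z ≥ 1`; this is where the truncation of the
potential at `1` enters. -/
theorem regret_constant_eq {c Z d : ℝ} (hZ : 1 ≤ Z) (hd : 0 < d) (hc : c = 2 * √(Z / d)) (L : ℝ) :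
    2 * Z / c * √L + √L / (2 * c) + d * c / 2 * √L ≤ 9 / 4 * √(L * Z * d) := by
  have hZ0 : 0 < Z := by linarith
  set p := √Z with hp
  set q := √d with hq
  have hp1 : 1 ≤ p := Real.one_le_sqrt.2 hZ
  have hq0 : 0 < q := Real.sqrt_pos.2 hd
  have hZp : Z = p ^ 2 := (Real.sq_sqrt hZ0.le).symm
  have hdq : d = q ^ 2 := (Real.sq_sqrt hd.le).symm
  have hcq : c = 2 * (p / q) := by rw [hc, Real.sqrt_div hZ0.le]
  have hR : √(L * Z * d) = √L * p * q := by
    rw [Real.sqrt_mul' _ hd.le, Real.sqrt_mul' _ hZ0.le]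
  rw [hR, hcq, hZp, hdq]
  have h1 : 2 * p ^ 2 / (2 * (p / q)) * √L = √L * p * q := by field_simp
  have h2 : q ^ 2 * (2 * (p / q)) / 2 * √L = √L * p * q := by field_simp
  have h3 : √L / (2 * (2 * (p / q))) ≤ √L * p * q / 4 := by
    have h4 : √L / (2 * (2 * (p / q))) = √L * q / 4 * (1 / p) := by field_simp; norm_num
    rw [h4]
    have h5 : 1 / p ≤ p := (div_le_one (by linarith)).2 hp1 |>.trans hp1
    calc √L * q / 4 * (1 / p) ≤ √L * q / 4 * p := by gcongr
      _ = _ := by ring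
  rw [h1, h2]
  linarith

theorem one_le_of_potential_eq {Ω X A Θ : Type*} [MeasurableSpace Ω] [MeasurableSpace X]
    [MeasurableSpace A] [MeasurableSpace Θ] {T : ℕ} {B : BanditProblem X A Θ T}
    {𝒮 : Set (Fin T → ℝ)} {run : (Fin T → ℝ) → Interaction Ω X A Θ T} {α c Z : ℝ}
    (hZ : potential B 𝒮 run α c = (Z : EReal)) : 1 ≤ Z := by
  have h : (1 : EReal) ≤ (Z : EReal) := hZ ▸ le_max_left _ _
  exact_mod_cast h

theorem roundPotential_le_of_potential_eq {Ω X A Θ : Type*} [MeasurableSpace Ω]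
    [MeasurableSpace X] [MeasurableSpace A] [MeasurableSpace Θ] {T : ℕ}
    {B : BanditProblem X A Θ T} {𝒮 : Set (Fin T → ℝ)}
    {run : (Fin T → ℝ) → Interaction Ω X A Θ T} {α c Z : ℝ}
    (hZ : potential B 𝒮 run α c = (Z : EReal)) {σ : Fin T → ℝ} (hσ : σ ∈ 𝒮) (t : Fin T) :
    (run σ).roundPotential B α c σ t ≤ Z := by
  have h : (((run σ).roundPotential B α c σ t : ℝ) : EReal) ≤ (Z : EReal) := by
    rw [← hZ]
    refine le_trans ?_ (le_max_right _ _)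
    exact (le_iSup (fun t => (((run σ).roundPotential B α c σ t : ℝ) : EReal)) t).trans
      (le_iSup₂ (f := fun σ (_ : σ ∈ 𝒮) =>
        ⨆ t, (((run σ).roundPotential B α c σ t : ℝ) : EReal)) σ hσ)
  exact_mod_cast h

/-! ### Regret decomposition and assembly -/

namespace Interaction

variable {Ω X A Θ : Type*} [MeasurableSpace Ω] [MeasurableSpace X] [MeasurableSpace A]
  [MeasurableSpace Θ] {T : ℕ} (I : Interaction Ω X A Θ T) (B : BanditProblem X A Θ T)

/-- The expected regret, split by the decoupling inequality into per-round error and feel-good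
terms. -/
theorem expectedRegret_le_sum {α c : ℝ} (hα : 0 < α) {σ : Fin T → ℝ}
    (hI : I.IsFGTSVA B α c σ) {γ : ℝ} (hγ : 0 < γ) :
    I.expectedRegret B ≤
      ∑ t, (γ * sigmaBar α σ t ^ 2 * ∫ ω, I.cumSqGap B α σ t (I.θ t ω) ω ∂I.P -
        ∫ ω, B.feelGood t (I.θ t ω) (I.x t ω) ∂I.P) +
      (γ * ∑ t, sigmaBar α σ t ^ 2 + (1 + 1 / (4 * γ)) * B.decoupling 1 (α ^ 2)⁻¹) := by
  have := I.P_prob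
  set K := γ * ∑ t, sigmaBar α σ t ^ 2 + (1 + 1 / (4 * γ)) * B.decoupling 1 (α ^ 2)⁻¹
  have hsq := fun t => (I.integrable_cumSqGap B α σ t).const_mul (γ * sigmaBar α σ t ^ 2)
  have hfg := I.integrable_feelGood B
  have hterm : ∀ t, Integrable (fun ω => γ * sigmaBar α σ t ^ 2 *
      I.cumSqGap B α σ t (I.θ t ω) ω - B.feelGood t (I.θ t ω) (I.x t ω)) I.P :=
    fun t => (hsq t).sub (hfg t)
  have hgap : ∀ t, Integrable (fun ω => B.gap (I.θ t ω) (I.x t ω) (I.a t ω)) I.P := fun t =>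
    Integrable.of_bound (B.measurable_gap_comp (I.measurable_θ t) (I.measurable_x t)
      (I.measurable_a t)).aestronglyMeasurable 1
      (Filter.Eventually.of_forall fun ω => B.abs_gap_le_one _ _ _)
  have hpt : ∀ ω, ∑ t, (B.gap (I.θ t ω) (I.x t ω) (I.a t ω) -
        B.feelGood t (I.θ t ω) (I.x t ω)) ≤
      ∑ t, (γ * sigmaBar α σ t ^ 2 * I.cumSqGap B α σ t (I.θ t ω) ω -
        B.feelGood t (I.θ t ω) (I.x t ω)) + K := by
    intro ω
    -- Admissible weights because `σ̄_t ≥ α`. The coefficient is uniform over point sequences and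
    -- functions, so it applies to each realized trajectory.
    have h := B.decouplingBound_decoupling zero_le_one (fun t => (I.x t ω, I.a t ω))
      (fun t => (sigmaBar α σ t ^ 2)⁻¹) (ε := (α ^ 2)⁻¹)
      (fun t => ⟨inv_pos.2 (pow_pos (sigmaBar_pos hα σ t) 2), inv_anti₀ (by positivity)
        (pow_le_pow_left₀ hα.le (le_max_right _ _) 2)⟩) (fun t => I.θ t ω) γ hγ
    simp only [one_div, div_inv_eq_mul, mul_one, one_mul] at h
    rw [Finset.sum_sub_distrib, Finset.sum_sub_distrib]
    simp only [BanditProblem.gap, cumSqGap, K, one_div]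
    linarith
  calc I.expectedRegret B
      = ∫ ω, ∑ t, (B.gap (I.θ t ω) (I.x t ω) (I.a t ω) -
          B.feelGood t (I.θ t ω) (I.x t ω)) ∂I.P := by
        simp only [expectedRegret, hI.regret_eq]
    _ ≤ ∫ ω, (∑ t, (γ * sigmaBar α σ t ^ 2 * I.cumSqGap B α σ t (I.θ t ω) ω -
          B.feelGood t (I.θ t ω) (I.x t ω)) + K) ∂I.P :=
        integral_mono (integrable_finsetSum _ fun t _ => (hgap t).sub (hfg t))
          ((integrable_finsetSum _ fun t _ => hterm t).add (integrable_const K)) hpt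
    _ = _ := by
        rw [integral_add (integrable_finsetSum _ fun t _ => hterm t) (integrable_const K),
          integral_finsetSum _ fun t _ => hterm t]
        simp only [integral_const, probReal_univ, one_smul]
        congr 1
        refine Finset.sum_congr rfl fun t _ => ?_
        rw [integral_sub (hsq t) (hfg t), integral_const_mul]

end Interaction

end

theorem theorem2 {Ω X A Θ : Type*} [MeasurableSpace Ω] [MeasurableSpace X] [MeasurableSpace A]
    [MeasurableSpace Θ] {T : ℕ} (B : BanditProblem X A Θ T) (α c Z : ℝ) (hα : 0 < α)
    (𝒮 : Set (Fin T → ℝ)) (h𝒮 : ∀ σ ∈ 𝒮, ∀ t, 0 ≤ σ t)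
    (run : (Fin T → ℝ) → Interaction Ω X A Θ T)
    (hrun : ∀ σ ∈ 𝒮, (run σ).IsFGTSVA B α c σ)
    (hZ : potential B 𝒮 run α c = (Z : EReal))
    (hdc : 0 < B.decoupling 1 (α ^ 2)⁻¹)
    (hc : c = 2 * √(Z / B.decoupling 1 (α ^ 2)⁻¹))
    (σ : Fin T → ℝ) (hσ : σ ∈ 𝒮) (hnoise : (run σ).SubgaussianNoise B σ) :
    (run σ).expectedRegret B ≤
      9 / 4 * √((α ^ 2 * T + ∑ t, σ t ^ 2) * Z * B.decoupling 1 (α ^ 2)⁻¹)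
        + B.decoupling 1 (α ^ 2)⁻¹ := by
  have hZ1 := one_le_of_potential_eq hZ
  have hcore := fun t => ((run σ).integral_cumSqGap_sub_feelGood_le B hα (h𝒮 σ hσ) (hrun σ hσ)
    hnoise t).trans (roundPotential_le_of_potential_eq hZ hσ t)
  have hsplit := fun γ hγ => (run σ).expectedRegret_le_sum B hα (hrun σ hσ) (γ := γ) hγ
  set D := B.decoupling 1 (α ^ 2)⁻¹
  -- With no rounds `L` would vanish and the `γ` below would not be positive.
  rcases isEmpty_or_nonempty (Fin T) with hT | ⟨⟨t₀⟩⟩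
  · have h0 : (run σ).expectedRegret B = 0 := by simp [Interaction.expectedRegret]
    rw [h0]
    positivity
  have hc0 : 0 < c := by
    rw [hc]
    have : 0 < Z := by linarith
    positivity
  set L := ∑ t, sigmaBar α σ t ^ 2 with hL
  have hLpos : 0 < L := (LambdaBar_pos hα σ t₀).trans_le (LambdaBar_le_sum α σ t₀)
  -- Dividing the bound of round `t` by `λ_t` leaves the squared error with coefficient `σ̄_t² / (2
  -- c √Λ_t)`, which must dominate `γ σ̄_t²`. As `Λ_t ≤ L`, this `γ` serves all rounds.
  set γ := 1 / (2 * c * √L) with hγdef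
  have hsL : 0 < √L := Real.sqrt_pos.2 hLpos
  have hγ : 0 < γ := by positivity
  have hround : ∀ t, γ * sigmaBar α σ t ^ 2 *
        ∫ ω, (run σ).cumSqGap B α σ t ((run σ).θ t ω) ω ∂(run σ).P -
        ∫ ω, B.feelGood t ((run σ).θ t ω) ((run σ).x t ω) ∂(run σ).P ≤
      Z / c * (sigmaBar α σ t ^ 2 / √(LambdaBar α σ t)) := by
    intro t
    have h := hcore t
    have hQ : 0 ≤ ∫ ω, (run σ).cumSqGap B α σ t ((run σ).θ t ω) ω ∂(run σ).P :=
      integral_nonneg fun ω => (run σ).cumSqGap_nonneg B σ t _ ω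
    set Q := ∫ ω, (run σ).cumSqGap B α σ t ((run σ).θ t ω) ω ∂(run σ).P
    set G := ∫ ω, B.feelGood t ((run σ).θ t ω) ((run σ).x t ω) ∂(run σ).P
    have hs : 0 < √(LambdaBar α σ t) := Real.sqrt_pos.2 (LambdaBar_pos hα σ t)
    have hb : 0 < sigmaBar α σ t ^ 2 := pow_pos (sigmaBar_pos hα σ t) 2
    have hγle : γ ≤ 1 / (2 * c * √(LambdaBar α σ t)) :=
      one_div_le_one_div_of_le (by positivity)
        (by gcongr; exact LambdaBar_le_sum α σ t)
    rw [feelGoodWeight] at h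
    set s := √(LambdaBar α σ t)
    set b := sigmaBar α σ t ^ 2
    have h1 : γ * b * Q ≤ 1 / (2 * c * s) * b * Q := by gcongr
    -- The factor `b / (c * s)` is `1 / λ_t`.
    have h2 := mul_le_mul_of_nonneg_left h (by positivity : 0 ≤ b / (c * s))
    have h3 : b / (c * s) * (Q / 2 - c * s / b * G) = 1 / (2 * c * s) * b * Q - G := by
      field_simp
    have h4 : b / (c * s) * Z = Z / c * (b / s) := by field_simp
    rw [h3, h4] at h2
    linarith
  have hsum : ∑ t, Z / c * (sigmaBar α σ t ^ 2 / √(LambdaBar α σ t)) ≤ 2 * Z / c * √L := by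
    rw [← Finset.mul_sum]
    have h := sum_div_sqrt_sum_Iic_le (b := fun t => sigmaBar α σ t ^ 2)
      fun t => pow_pos (sigmaBar_pos hα σ t) 2
    calc Z / c * ∑ t, sigmaBar α σ t ^ 2 / √(LambdaBar α σ t) ≤ Z / c * (2 * √L) :=
          mul_le_mul_of_nonneg_left h (by positivity)
      _ = 2 * Z / c * √L := by ring
  have hγL : γ * L = √L / (2 * c) := by
    rw [hγdef]
    nth_rewrite 2 [← Real.mul_self_sqrt hLpos.le]
    field_simp
  have hγD : (1 + 1 / (4 * γ)) * D = D + D * c / 2 * √L := by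
    rw [hγdef]
    field_simp
    ring
  have hfin := regret_constant_eq hZ1 hdc hc L
  have hmono : √(L * Z * D) ≤ √((α ^ 2 * T + ∑ t, σ t ^ 2) * Z * D) := by
    have := sum_sigmaBar_sq_le α σ
    gcongr
  have hle := Finset.sum_le_sum fun t (_ : t ∈ Finset.univ) => hround t
  have := hsplit γ hγ
  rw [hγL, hγD] at this
  linarith
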